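/- A quandle is a set $Q$ with binary operations $*$, $\backslash$ such that $a*(a\backslash b)=a\backslash(a*b)=b$, $a*(b*c)=(a*b)*(a*c)$ and $a*a=a$ for all $a,b,c\in Q$. Write $L_a(b)=a*b$. A subquandle is a subset closed under $*$ and $\backslash$; it is called proper if it has more than one element and is different from $Q$. A quandle is strictly simple if it has no proper subquandles, and locally strictly simple (LSS) if all its proper subquandles are strictly simple. A congruence of $Q$ is an equivalence relation compatible with $*$ and $\backslash$; $0_Q$ and $1_Q$ denote the equality relation and $Q\times Q$. $Q$ is subdirectly irreducible if the intersection of all congruences different from $0_Q$ is different from $0_Q$. $Q$ is connected if the group $\langle L_a : a\in Q\rangle$ is transitive on $Q$. $Q$ is abelian if for every term $t(x,y)$ in two tuples of variables and all tuples $a,b,u,v$ of elements of $Q$, $t(a,u)=t(a,v)$ implies $t(b,u)=t(b,v)$. Let $\gamma_Q$ be the smallest congruence of $Q$ with abelian factor. Let $\mathrm{Dis}(Q)=\langle L_aL_b^{-1} : a,b\in Q\rangle$ and, for a congruence $\alpha$, $\mathrm{Dis}_\alpha=\langle L_aL_b^{-1} : a\,\alpha\, b\rangle$. Let $\sigma_Q$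 be the equivalence relation on $Q$ with $a\,\sigma_Q\,b$ if and only if the stabilizers of $a$ and $b$ in $\mathrm{Dis}(Q)$ coincide. For a group $G$ put $\gamma_1(G)=[G,G]$ and $\gamma_2(G)=[\gamma_1(G),G]$. For primes $p,q$, let $\mathcal{LSS}(p^m,q^n,\sigma_Q)$ be the class of finite connected non-abelian subdirectly irreducible LSS quandles $Q$, with the given $\sigma_Q$, having exactly one congruence different from $0_Q$ and $1_Q$, this congruence having blocks of size $p^m$ and a factor of size $q^n$. **Theorem.** Let $p\neq q$ be primes and let $Q\in\mathcal{LSS}(p^m,q^n,\sigma_Q)$ with $\gamma_Q\leq\sigma_Q$. Then there are an integer $k$ with $0\leq k\leq m$ and a faithful action $\rho:\mathbb{Z}_q^n\to\mathrm{Aut}(\mathbb{Z}_p^{m+k})$ such that $$\mathrm{Dis}(Q)\cong\mathbb{Z}_p^{m+k}\rtimes_\rho\mathbb{Z}_q^n,$$ and moreover $\gamma_1(\mathrm{Dis}(Q))=\gamma_2(\mathrm{Dis}(Q))=\mathrm{Dis}_{\gamma_Q}$. -/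

import Mathlib

open Quandles

namespace LSSQuandle

/-! Mathlib's `Quandle` has the operations `a ◃ b` (the product `a * b`) and `a ◃⁻¹ b`
(the left division `a \ b`); `Rack.act' a` is the left multiplication `L_a` as a permutation. -/

/-! ### Subquandles -/

/-- A subquandle: a subset closed under both quandle operations. -/
structure Subquandle (Q : Type*) [Quandle Q] where
  carrier : Set Q
  act_mem : ∀ {a b : Q}, a ∈ carrier → b ∈ carrier → a ◃ b ∈ carrier
  invAct_mem : ∀ {a b : Q}, a ∈ carrier → b ∈ carrier → a ◃⁻¹ b ∈ carrier

instance Subquandle.instQuandle {Q : Type*} [Quandle Q] (S : Subquandle Q) :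
    Quandle S.carrier where
  act a b := ⟨a.1 ◃ b.1, S.act_mem a.2 b.2⟩
  self_distrib := Subtype.ext Shelf.self_distrib
  invAct a b := ⟨a.1 ◃⁻¹ b.1, S.invAct_mem a.2 b.2⟩
  left_inv a b := Subtype.ext (Rack.left_inv a.1 b.1)
  right_inv a b := Subtype.ext (Rack.right_inv a.1 b.1)
  fix := Subtype.ext Quandle.fix

/-- A proper subquandle has more than one element and is not the whole quandle. -/
def Subquandle.IsProper {Q : Type*} [Quandle Q] (S : Subquandle Q) : Prop :=
  S.carrier.Nontrivial ∧ S.carrier ≠ Set.univ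

/-- A quandle is strictly simple if it has no proper subquandles. -/
def IsStrictlySimple (Q : Type*) [Quandle Q] : Prop :=
  ∀ S : Subquandle Q, ¬ S.IsProper

/-- A quandle is locally strictly simple if all its proper subquandles are strictly simple. -/
def IsLocallyStrictlySimple (Q : Type*) [Quandle Q] : Prop :=
  ∀ S : Subquandle Q, S.IsProper → IsStrictlySimple S.carrier

/-! ### Congruences and factors -/

/-- A congruence: an equivalence relation compatible with both quandle operations. -/
@[ext]
structure Congruence (Q : Type*) [Quandle Q] extends Setoid Q where
  act_compat : ∀ {a a' b b' : Q}, r a a' → r b b' → r (a ◃ b) (a' ◃ b')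
  invAct_compat : ∀ {a a' b b' : Q}, r a a' → r b b' → r (a ◃⁻¹ b) (a' ◃⁻¹ b')

namespace Congruence

/-- The identity congruence `0_Q`. -/
instance instBot {Q : Type*} [Quandle Q] : Bot (Congruence Q) where
  bot :=
    { toSetoid := ⊥
      act_compat := fun h k => by cases h; cases k; rfl
      invAct_compat := fun h k => by cases h; cases k; rfl }

/-- The full congruence `1_Q = Q × Q`. -/
instance instTop {Q : Type*} [Quandle Q] : Top (Congruence Q) where
  top :=
    { toSetoid := ⊤
      act_compat := fun _ _ => trivial
      invAct_compat := fun _ _ => trivial }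

/-- The intersection of a set of congruences. -/
instance instInfSet {Q : Type*} [Quandle Q] : InfSet (Congruence Q) where
  sInf A :=
    { r := fun a b => ∀ α ∈ A, α.r a b
      iseqv := ⟨fun a α _ => α.iseqv.refl a, fun h α hα => α.iseqv.symm (h α hα),
        fun h k α hα => α.iseqv.trans (h α hα) (k α hα)⟩
      act_compat := fun h k α hα => α.act_compat (h α hα) (k α hα)
      invAct_compat := fun h k α hα => α.invAct_compat (h α hα) (k α hα) }

/-- The underlying set of the factor `Q / α`. -/
abbrev Factor {Q : Type*} [Quandle Q] (α : Congruence Q) : Type _ := Quotient α.toSetoid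

instance instQuandleFactor {Q : Type*} [Quandle Q] (α : Congruence Q) : Quandle α.Factor where
  act := Quotient.map₂ (fun a b => a ◃ b) (fun _ _ h _ _ k => α.act_compat h k)
  self_distrib := by
    intro x y z
    induction x using Quotient.inductionOn
    induction y using Quotient.inductionOn
    induction z using Quotient.inductionOn
    exact congrArg (Quotient.mk α.toSetoid) Shelf.self_distrib
  invAct := Quotient.map₂ (fun a b => a ◃⁻¹ b) (fun _ _ h _ _ k => α.invAct_compat h k)
  left_inv := by
    intro x y
    induction x using Quotient.inductionOn
    induction y using Quotient.inductionOn
    exact congrArg (Quotient.mk α.toSetoid) (Rack.left_inv _ _)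
  right_inv := by
    intro x y
    induction x using Quotient.inductionOn
    induction y using Quotient.inductionOn
    exact congrArg (Quotient.mk α.toSetoid) (Rack.right_inv _ _)
  fix := by
    intro x
    induction x using Quotient.inductionOn
    exact congrArg (Quotient.mk α.toSetoid) Quandle.fix

/-- The block `[a]_α`. -/
def block {Q : Type*} [Quandle Q] (α : Congruence Q) (a : Q) : Set Q := {b | α.r a b}

end Congruence

/-- A quandle is subdirectly irreducible if the intersection of all its non-trivial congruences
is non-trivial. -/
def IsSubdirectlyIrreducible (Q : Type*) [Quandle Q] : Prop :=
  sInf {α : Congruence Q | α ≠ ⊥} ≠ ⊥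

/-! ### Abelian quandles in the sense of commutator theory -/

/-- Terms in the operations `*`, `\` with variables in `X`. -/
inductive QTerm (X : Type) : Type
  | var (x : X) : QTerm X
  | act (s t : QTerm X) : QTerm X
  | invAct (s t : QTerm X) : QTerm X

/-- The value of a term in a quandle under an assignment of the variables. -/
def QTerm.eval {X : Type} {Q : Type*} [Quandle Q] (e : X → Q) : QTerm X → Q
  | .var x => e x
  | .act s t => s.eval e ◃ t.eval e
  | .invAct s t => s.eval e ◃⁻¹ t.eval e

/-- A quandle is abelian if it satisfies the term condition: for every term `t(x, y)` in two
tuples of variables, `t(a, u) = t(a, v)` implies `t(b, u) = t(b, v)`. -/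
def IsAbelian (Q : Type*) [Quandle Q] : Prop :=
  ∀ (m n : ℕ) (t : QTerm (Fin m ⊕ Fin n)) (a b : Fin m → Q) (u v : Fin n → Q),
    t.eval (Sum.elim a u) = t.eval (Sum.elim a v) →
      t.eval (Sum.elim b u) = t.eval (Sum.elim b v)

/-- The congruence `γ_Q`: the smallest congruence with abelian factor. -/
def gammaCon (Q : Type*) [Quandle Q] : Congruence Q :=
  sInf {α : Congruence Q | IsAbelian α.Factor}

theorem QTerm.eval_mk {X : Type} {Q : Type*} [Quandle Q] (α : Congruence Q) (e : X → Q)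
    (t : QTerm X) :
    t.eval (fun x => (Quotient.mk α.toSetoid (e x) : α.Factor)) =
      Quotient.mk α.toSetoid (t.eval e) := by
  induction t with
  | var x => rfl
  | act s t hs ht => simp only [QTerm.eval, hs, ht]; rfl
  | invAct s t hs ht => simp only [QTerm.eval, hs, ht]; rfl

theorem isAbelian_factor_iff {Q : Type*} [Quandle Q] (α : Congruence Q) :
    IsAbelian α.Factor ↔
      ∀ (m n : ℕ) (t : QTerm (Fin m ⊕ Fin n)) (a b : Fin m → Q) (u v : Fin n → Q),
        α.r (t.eval (Sum.elim a u)) (t.eval (Sum.elim a v)) →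
          α.r (t.eval (Sum.elim b u)) (t.eval (Sum.elim b v)) := by
  have key : ∀ (m n : ℕ) (t : QTerm (Fin m ⊕ Fin n)) (a : Fin m → Q) (u : Fin n → Q),
      t.eval (Sum.elim (fun i => (Quotient.mk α.toSetoid (a i) : α.Factor))
        (fun i => Quotient.mk α.toSetoid (u i))) =
      Quotient.mk α.toSetoid (t.eval (Sum.elim a u)) := by
    intro m n t a u
    rw [← QTerm.eval_mk]
    congr 1
    funext x
    cases x <;> rfl
  constructor
  · intro h m n t a b u v hr
    have := h m n t (fun i => Quotient.mk α.toSetoid (a i)) (fun i => Quotient.mk α.toSetoid (b i))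
      (fun i => Quotient.mk α.toSetoid (u i)) (fun i => Quotient.mk α.toSetoid (v i))
    rw [key, key, key, key] at this
    exact Quotient.exact (this (Quotient.sound hr))
  · intro h m n t a b u v hr
    obtain ⟨a, rfl⟩ : ∃ a' : Fin m → Q, a = fun i => Quotient.mk α.toSetoid (a' i) :=
      ⟨fun i => (a i).out, funext fun i => ((a i).out_eq).symm⟩
    obtain ⟨b, rfl⟩ : ∃ a' : Fin m → Q, b = fun i => Quotient.mk α.toSetoid (a' i) :=
      ⟨fun i => (b i).out, funext fun i => ((b i).out_eq).symm⟩
    obtain ⟨u, rfl⟩ : ∃ a' : Fin n → Q, u = fun i => Quotient.mk α.toSetoid (a' i) :=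
      ⟨fun i => (u i).out, funext fun i => ((u i).out_eq).symm⟩
    obtain ⟨v, rfl⟩ : ∃ a' : Fin n → Q, v = fun i => Quotient.mk α.toSetoid (a' i) :=
      ⟨fun i => (v i).out, funext fun i => ((v i).out_eq).symm⟩
    rw [key, key] at hr ⊢
    exact Quotient.sound (h m n t a b u v (Quotient.exact hr))

/-- The factor over `gammaCon Q` is abelian, so `gammaCon Q` is indeed the smallest congruence
with abelian factor. -/
theorem isAbelian_factor_gammaCon (Q : Type*) [Quandle Q] : IsAbelian (gammaCon Q).Factor := by
  rw [isAbelian_factor_iff]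
  intro m n t a b u v hr α hα
  exact (isAbelian_factor_iff α).1 hα m n t a b u v (hr α hα)

/-! ### Left multiplication group, displacement groups, and `σ_Q` -/

/-- The left multiplication group `LMlt(Q)`. -/
def LMlt (Q : Type*) [Quandle Q] : Subgroup (Equiv.Perm Q) :=
  Subgroup.closure (Set.range fun a : Q => (Rack.act' a : Equiv.Perm Q))

/-- The displacement group `Dis(Q)`. -/
def Dis (Q : Type*) [Quandle Q] : Subgroup (Equiv.Perm Q) :=
  Subgroup.closure {g | ∃ a b : Q, g = (Rack.act' a : Equiv.Perm Q) * (Rack.act' b)⁻¹}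

/-- The displacement group `Dis_α` relative to the congruence `α`. -/
def relDis {Q : Type*} [Quandle Q] (α : Congruence Q) : Subgroup (Equiv.Perm Q) :=
  Subgroup.closure {g | ∃ a b : Q, α.r a b ∧ g = (Rack.act' a : Equiv.Perm Q) * (Rack.act' b)⁻¹}

/-- A quandle is connected if `LMlt(Q)` acts transitively on it. -/
def IsConnected (Q : Type*) [Quandle Q] : Prop :=
  MulAction.IsPretransitive (LMlt Q) Q

/-- The equivalence relation `σ_Q`: equality of the point stabilizers in `Dis(Q)`. -/
def sigmaRel (Q : Type*) [Quandle Q] : Setoid Q :=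
  Setoid.ker fun a : Q => MulAction.stabilizer (Dis Q) a

/-! ### The classes `LSS(M, N, s)` -/

/-- `Q` belongs to `LSS(M, N, s)`: `Q` is a finite, connected, non-abelian, subdirectly irreducible
locally strictly simple quandle with `σ_Q = s`, having exactly one congruence other than `0_Q` and
`1_Q`, and this congruence has blocks of size `M` and a factor of size `N`. -/
structure MemLSS (Q : Type*) [Quandle Q] (M N : ℕ) (s : Setoid Q) : Prop where
  finite : Finite Q
  connected : IsConnected Q
  lss : IsLocallyStrictlySimple Q
  not_abelian : ¬ IsAbelian Q
  subdirectlyIrreducible : IsSubdirectlyIrreducible Q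
  sigma_eq : sigmaRel Q = s
  exists_congruence : ∃ α : Congruence Q, α ≠ ⊥ ∧ α ≠ ⊤ ∧
    (∀ β : Congruence Q, β ≠ ⊥ → β ≠ ⊤ → β = α) ∧
    (∀ a : Q, Nat.card (α.block a) = M) ∧ Nat.card α.Factor = N

end LSSQuandle

namespace LSSQuandle

/-! Let `α` be the unique congruence other than `0_Q` and `1_Q`, and let `K = kerDis α` be the
kernel of the action of `Dis(Q)` on `Q/α`. Everything rests on one dictionary: a subgroup of
`LMlt(Q)` normalised by `LMlt(Q)` has orbits that form a congruence (`orbitCon`), so a nontrivial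
one is transitive on each block of `α` (`exists_mem_of_rel`).

The top factor: by the LSS property `Q/α` is strictly simple, and a connected strictly simple
quandle of prime power size has a regular elementary abelian displacement group
(`IsStrictlySimple.dis_regular`). Hence `Q/α` is abelian, `γ_Q = α`, and `Dis(Q)/K` is elementary
abelian of order `q^n`.

The kernel: since `γ_Q ≤ σ_Q`, point stabilizers are constant on blocks. This makes `K` a `p`-group,
and comparing it with the elements of order dividing `p` in its centre shows that `K` is elementary
abelian (`HasRegularFactor.kerDis_comm`). A block is a `K`-orbit, and an element of `K` is
determined by its values at two points of different blocks, so `|K| = p^(m+k)` with `k ≤ m`.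

As `p ≠ q`, the extension splits. The kernel of the action on `K` consists of central elements of
order dividing `q`; these are trivial, since otherwise some nontrivial one would lie in `K`. Finally
`[Dis(Q), Dis(Q)] ≤ Dis_α`, while `[[Dis(Q), Dis(Q)], Dis(Q)]` is nontrivial, so transitive on
blocks, and therefore contains `Dis_α`. -/

theorem perm_apply_inv {X : Type*} (f : Equiv.Perm X) (x : X) : f (f⁻¹ x) = x :=
  Equiv.apply_symm_apply f x

theorem perm_inv_apply {X : Type*} (f : Equiv.Perm X) (x : X) : f⁻¹ (f x) = x :=
  Equiv.symm_apply_apply f x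

/-! ### Invariant subgroups of `LMlt(Q)`, orbit congruences, and abelianness -/

section Basic

variable {Q : Type*} [Quandle Q]

/-- The left multiplication `L_a`. -/
abbrev leftMul (a : Q) : Equiv.Perm Q := Rack.act' a

theorem leftMul_mem (a : Q) : leftMul a ∈ LMlt Q :=
  Subgroup.subset_closure ⟨a, rfl⟩

theorem leftMul_self (a : Q) : leftMul a a = a := Quandle.fix

theorem conj_leftMul {h : Equiv.Perm Q} (hh : h ∈ LMlt Q) (a : Q) :
    h * leftMul a * h⁻¹ = leftMul (h a) := by
  induction hh using Subgroup.closure_induction generalizing a with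
  | mem x hx =>
    obtain ⟨b, rfl⟩ := hx
    exact (Rack.ad_conj b a).symm
  | one => simp
  | mul x y _ _ hx hy =>
    rw [Equiv.Perm.mul_apply, ← hx, ← hy]; group
  | inv x _ hx =>
    have := hx (x⁻¹ a)
    rw [perm_apply_inv] at this
    rw [← this]; group

theorem map_act_of_mem_lMlt {h : Equiv.Perm Q} (hh : h ∈ LMlt Q) (a b : Q) :
    h (a ◃ b) = h a ◃ h b := by
  change h (leftMul a b) = leftMul (h a) (h b)
  rw [← conj_leftMul hh]; simp

theorem map_invAct_of_mem_lMlt {h : Equiv.Perm Q} (hh : h ∈ LMlt Q) (a b : Q) :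
    h (a ◃⁻¹ b) = h a ◃⁻¹ h b := by
  change h ((leftMul a)⁻¹ b) = (leftMul (h a))⁻¹ (h b)
  rw [← conj_leftMul hh]; simp [mul_assoc]

/-- A set of permutations normalised by `LMlt(Q)`. -/
def IsInvariant (N : Subgroup (Equiv.Perm Q)) : Prop :=
  ∀ h ∈ LMlt Q, ∀ g ∈ N, h * g * h⁻¹ ∈ N

theorem mul_inv_mem_dis (a b : Q) : leftMul a * (leftMul b)⁻¹ ∈ Dis Q :=
  Subgroup.subset_closure ⟨a, b, rfl⟩

theorem dis_le_lMlt : Dis Q ≤ LMlt Q := by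
  rw [Dis, Subgroup.closure_le]
  rintro _ ⟨a, b, rfl⟩
  exact mul_mem (leftMul_mem a) (inv_mem (leftMul_mem b))

theorem isInvariant_closure {S : Set (Equiv.Perm Q)}
    (hS : ∀ h ∈ LMlt Q, ∀ g ∈ S, h * g * h⁻¹ ∈ S) : IsInvariant (Subgroup.closure S) := by
  intro h hh g hg
  induction hg using Subgroup.closure_induction with
  | mem x hx => exact Subgroup.subset_closure (hS h hh x hx)
  | one => simp
  | mul x y _ _ hx hy =>
    have := mul_mem hx hy
    rwa [show h * x * h⁻¹ * (h * y * h⁻¹) = h * (x * y) * h⁻¹ by group] at this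
  | inv x _ hx =>
    have := inv_mem hx
    rwa [show (h * x * h⁻¹)⁻¹ = h * x⁻¹ * h⁻¹ by group] at this

theorem conj_leftMul_mul_inv {h : Equiv.Perm Q} (hh : h ∈ LMlt Q) (a b : Q) :
    h * (leftMul a * (leftMul b)⁻¹) * h⁻¹ = leftMul (h a) * (leftMul (h b))⁻¹ := by
  rw [← conj_leftMul hh, ← conj_leftMul hh]; group

theorem isInvariant_dis : IsInvariant (Dis Q) := by
  apply isInvariant_closure
  rintro h hh _ ⟨a, b, rfl⟩
  exact ⟨h a, h b, conj_leftMul_mul_inv hh a b⟩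

theorem Congruence.rel_apply_iff (α : Congruence Q) {h : Equiv.Perm Q} (hh : h ∈ LMlt Q)
    {a b : Q} : α.r (h a) (h b) ↔ α.r a b := by
  induction hh using Subgroup.closure_induction generalizing a b with
  | mem x hx =>
    obtain ⟨c, rfl⟩ := hx
    refine ⟨fun hab => ?_, fun hab => α.act_compat (α.iseqv.refl c) hab⟩
    have := α.invAct_compat (α.iseqv.refl c) hab
    change α.r ((leftMul c)⁻¹ (leftMul c a)) ((leftMul c)⁻¹ (leftMul c b)) at this
    rwa [perm_inv_apply, perm_inv_apply] at this
  | one => rfl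
  | mul x y _ _ hx hy => exact hx.trans hy
  | inv x _ hx =>
    rw [← hx, perm_apply_inv, perm_apply_inv]

theorem isInvariant_relDis (α : Congruence Q) : IsInvariant (relDis α) := by
  apply isInvariant_closure
  rintro h hh _ ⟨a, b, hab, rfl⟩
  exact ⟨h a, h b, (α.rel_apply_iff hh).2 hab, conj_leftMul_mul_inv hh a b⟩

theorem IsInvariant.commutator {M N : Subgroup (Equiv.Perm Q)} (hM : IsInvariant M)
    (hN : IsInvariant N) : IsInvariant ⁅M, N⁆ := by
  rw [Subgroup.commutator_def]
  apply isInvariant_closure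
  rintro h hh _ ⟨a, ha, b, hb, rfl⟩
  refine ⟨_, hM h hh a ha, _, hN h hh b hb, ?_⟩
  simp only [commutatorElement_def]; group

/-- As `L_x` fixes `x`, the maps `L_c` and `L_c L_x⁻¹` agree at `x`. Thus `LMlt(Q)` and `Dis(Q)`
have the same orbits. -/
theorem exists_mem_dis_apply_eq {h : Equiv.Perm Q} (hh : h ∈ LMlt Q) (x : Q) :
    ∃ g ∈ Dis Q, h x = g x := by
  induction hh using Subgroup.closure_induction generalizing x with
  | mem y hy =>
    obtain ⟨c, rfl⟩ := hy
    refine ⟨_, mul_inv_mem_dis c x, ?_⟩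
    have : (leftMul x)⁻¹ x = x := by rw [Equiv.Perm.inv_eq_iff_eq, leftMul_self]
    rw [Equiv.Perm.mul_apply, this]
  | one => exact ⟨1, one_mem _, rfl⟩
  | mul y z _ _ hy hz =>
    obtain ⟨g, hg, h1⟩ := hz x
    obtain ⟨g', hg', h2⟩ := hy (g x)
    exact ⟨g' * g, mul_mem hg' hg, by simp [h1, h2]⟩
  | inv y hy hi =>
    obtain ⟨g, hg, h1⟩ := hi (y⁻¹ x)
    have h2 := isInvariant_dis _ (inv_mem hy) _ (inv_mem hg)
    refine ⟨g⁻¹, inv_mem hg, ?_⟩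
    rw [perm_apply_inv] at h1
    rw [Equiv.Perm.eq_inv_iff_eq, ← h1]

theorem IsConnected.exists_mem_dis (hQ : IsConnected Q) (a b : Q) : ∃ g ∈ Dis Q, g a = b := by
  obtain ⟨h, hh⟩ := hQ.exists_smul_eq a b
  obtain ⟨g, hg, hga⟩ := exists_mem_dis_apply_eq h.2 a
  exact ⟨g, hg, hga.symm.trans hh⟩

/-- The congruence whose blocks are the orbits of an invariant subgroup of `LMlt(Q)`. -/
def orbitCon (N : Subgroup (Equiv.Perm Q)) (hN : N ≤ LMlt Q) (hi : IsInvariant N) :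
    Congruence Q where
  r a b := ∃ g ∈ N, g a = b
  iseqv := ⟨fun _ => ⟨1, one_mem _, rfl⟩,
    by rintro a _ ⟨g, hg, rfl⟩; exact ⟨g⁻¹, inv_mem hg, by simp⟩,
    by rintro a _ _ ⟨g, hg, rfl⟩ ⟨h, hh, rfl⟩; exact ⟨h * g, mul_mem hh hg, by simp⟩⟩
  act_compat := by
    rintro a _ b _ ⟨g, hg, rfl⟩ ⟨h, hh, rfl⟩
    have := hi _ (leftMul_mem a) _ (mul_mem (inv_mem hg) hh)
    refine ⟨_, mul_mem hg this, ?_⟩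
    change _ = leftMul (g a) (h b)
    rw [← conj_leftMul (hN hg)]
    change (g * (leftMul a * (g⁻¹ * h) * (leftMul a)⁻¹)) (leftMul a b) = _
    simp
  invAct_compat := by
    rintro a _ b _ ⟨g, hg, rfl⟩ ⟨h, hh, rfl⟩
    have := hi _ (inv_mem (leftMul_mem a)) _ (mul_mem (inv_mem hg) hh)
    refine ⟨_, mul_mem hg this, ?_⟩
    change _ = (leftMul (g a))⁻¹ (h b)
    rw [← conj_leftMul (hN hg)]
    change (_ * ((leftMul a)⁻¹ * (g⁻¹ * h) * _⁻¹⁻¹)) ((leftMul a)⁻¹ b) = _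
    simp [mul_assoc]

theorem orbitCon_ne_bot {N : Subgroup (Equiv.Perm Q)} (hN : N ≤ LMlt Q) (hi : IsInvariant N)
    (h : N ≠ ⊥) : orbitCon N hN hi ≠ ⊥ := by
  intro hb
  apply h
  rw [Subgroup.eq_bot_iff_forall]
  intro g hg
  ext x
  have : (orbitCon N hN hi).r x (g x) := ⟨g, hg, rfl⟩
  rw [hb] at this
  exact (show x = g x from this).symm

/-- Writing `a = g b` gives `L_a L_b⁻¹ = g (L_b g⁻¹ L_b⁻¹)`, and both factors lie in `N`. -/
theorem dis_le_of_transitive {N : Subgroup (Equiv.Perm Q)} (hN : N ≤ LMlt Q) (hi : IsInvariant N)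
    (ht : ∀ a b : Q, ∃ g ∈ N, g a = b) : Dis Q ≤ N := by
  rw [Dis, Subgroup.closure_le]
  rintro _ ⟨a, b, rfl⟩
  obtain ⟨g, hg, rfl⟩ := ht b a
  change leftMul (g b) * (leftMul b)⁻¹ ∈ N
  rw [← conj_leftMul (hN hg)]
  have := mul_mem hg (hi _ (leftMul_mem b) _ (inv_mem hg))
  rwa [← mul_assoc, ← mul_assoc] at this

/-- If the orbits of the invariant subgroup `N` contain the blocks of `α`, then `Dis_α ≤ N`. -/
theorem relDis_le {α : Congruence Q} {N : Subgroup (Equiv.Perm Q)} (hN : N ≤ LMlt Q)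
    (hi : IsInvariant N) (ht : ∀ a b : Q, α.r a b → ∃ g ∈ N, g a = b) : relDis α ≤ N := by
  rw [relDis, Subgroup.closure_le]
  rintro _ ⟨a, b, hab, rfl⟩
  obtain ⟨g, hg, rfl⟩ := ht b a (α.iseqv.symm hab)
  change leftMul (g b) * (leftMul b)⁻¹ ∈ N
  rw [← conj_leftMul (hN hg)]
  have := mul_mem hg (hi _ (leftMul_mem b) _ (inv_mem hg))
  rwa [← mul_assoc, ← mul_assoc] at this

/-- The central elements of `P` whose order divides `p`. -/
def omegaCenter {G : Type*} [Group G] (p : ℕ) (P : Subgroup G) : Subgroup G where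
  carrier := {g | g ∈ P ∧ (∀ h ∈ P, h * g = g * h) ∧ g ^ p = 1}
  one_mem' := ⟨one_mem _, by simp, by simp⟩
  mul_mem' := by
    rintro a b ⟨ha, ha', hap⟩ ⟨hb, hb', hbp⟩
    refine ⟨mul_mem ha hb, fun h hh => ?_, ?_⟩
    · rw [← mul_assoc, ha' h hh, mul_assoc, hb' h hh, mul_assoc]
    · rw [(show Commute a b from hb' a ha).mul_pow, hap, hbp, one_mul]
  inv_mem' := by
    rintro a ⟨ha, ha', hap⟩
    refine ⟨inv_mem ha, fun h hh => ?_, by simp [hap]⟩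
    exact (show Commute h a from ha' h hh).inv_right

theorem omegaCenter_le {G : Type*} [Group G] (p : ℕ) (P : Subgroup G) : omegaCenter p P ≤ P :=
  fun _ h => h.1

theorem omegaCenter_ne_bot {G : Type*} [Group G] [Finite G] {p : ℕ} [Fact p.Prime]
    {P : Subgroup G} (hP : IsPGroup p P) (h : P ≠ ⊥) : omegaCenter p P ≠ ⊥ := by
  have : Nontrivial P := (Subgroup.nontrivial_iff_ne_bot P).2 h
  have := hP.center_nontrivial
  have hc : IsPGroup p (Subgroup.center P) := hP.to_subgroup _
  obtain ⟨k, hk⟩ := IsPGroup.iff_card.1 hc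
  have h1 : 1 < Nat.card (Subgroup.center P) := Finite.one_lt_card
  have hd : p ∣ Nat.card (Subgroup.center P) := by
    rw [hk] at h1 ⊢
    refine dvd_pow_self p ?_
    rintro rfl
    simp at h1
  obtain ⟨z, hz⟩ := exists_prime_orderOf_dvd_card' p hd
  intro hb
  have hm : ((z : P) : G) ∈ omegaCenter p P := by
    refine ⟨z.1.2, fun h hh => ?_, ?_⟩
    · exact congrArg Subtype.val (Subgroup.mem_center_iff.1 z.2 ⟨h, hh⟩)
    · have : z ^ p = 1 := by rw [← hz]; exact pow_orderOf_eq_one z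
      simpa using congrArg (fun x : Subgroup.center P => ((x : P) : G)) this
  rw [hb, Subgroup.mem_bot] at hm
  have : z = 1 := by ext1; ext1; exact hm
  rw [this, orderOf_one] at hz
  exact (Fact.out : p.Prime).one_lt.ne hz

theorem IsInvariant.omegaCenter {P : Subgroup (Equiv.Perm Q)} (hP : IsInvariant P) (p : ℕ) :
    IsInvariant (omegaCenter p P) := by
  rintro h hh g ⟨hg, hc, hp⟩
  refine ⟨hP h hh g hg, fun k hk => ?_, ?_⟩
  · have := hc _ (hP _ (inv_mem hh) k hk)
    rw [inv_inv] at this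
    calc k * (h * g * h⁻¹) = h * (h⁻¹ * k * h * g) * h⁻¹ := by group
      _ = h * g * h⁻¹ * k := by rw [this]; group
  · rw [conj_pow, hp]; simp

/-- The points fixed by a subgroup of `LMlt(Q)`. -/
def fixedSubquandle (N : Subgroup (Equiv.Perm Q)) (hN : N ≤ LMlt Q) : Subquandle Q where
  carrier := {x | ∀ g ∈ N, g x = x}
  act_mem := by
    intro a b ha hb g hg
    rw [map_act_of_mem_lMlt (hN hg), ha g hg, hb g hg]
  invAct_mem := by
    intro a b ha hb g hg
    rw [map_invAct_of_mem_lMlt (hN hg), ha g hg, hb g hg]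

/-- A block of a congruence as a subquandle. -/
def Congruence.blockSubquandle (α : Congruence Q) (a : Q) : Subquandle Q where
  carrier := α.block a
  act_mem := by
    intro b c hb hc
    have := α.act_compat (show α.r a b from hb) (show α.r a c from hc)
    rwa [show a ◃ a = a from Quandle.fix] at this
  invAct_mem := by
    intro b c hb hc
    have := α.invAct_compat (show α.r a b from hb) (show α.r a c from hc)
    rwa [show a ◃⁻¹ a = a from Quandle.fix_inv] at this

/-- A quandle with a commutative, semiregular and transitive displacement group is abelian. -/
theorem isAbelian_of_dis (hc : ∀ g ∈ Dis Q, ∀ h ∈ Dis Q, g * h = h * g)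
    (ht : ∀ a b : Q, ∃ g ∈ Dis Q, g a = b) : IsAbelian Q := by
  -- A transitive commutative permutation group is semiregular.
  have hs : ∀ g ∈ Dis Q, ∀ a : Q, g a = a → g = 1 := by
    intro g hg a ha
    ext b
    obtain ⟨h, hh, rfl⟩ := ht a b
    rw [← Equiv.Perm.mul_apply, hc g hg h hh, Equiv.Perm.mul_apply, ha]
    rfl
  -- `L_x` and `L_y` differ by an element of the commutative group `Dis(Q)`, so they induce the same
  -- automorphism of it.
  have conj_eq : ∀ (k : Equiv.Perm Q), k ∈ Dis Q → ∀ x y : Q,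
      leftMul x * k * (leftMul x)⁻¹ = leftMul y * k * (leftMul y)⁻¹ := by
    intro k hk x y
    have h1 := hc _ (isInvariant_dis _ (leftMul_mem y) _ hk) _ (mul_inv_mem_dis x y)
    calc leftMul x * k * (leftMul x)⁻¹
        = (leftMul x * (leftMul y)⁻¹) * (leftMul y * k * (leftMul y)⁻¹) *
          (leftMul x * (leftMul y)⁻¹)⁻¹ := by group
      _ = _ := by rw [← h1]; group
  have conj_eq' : ∀ (k : Equiv.Perm Q), k ∈ Dis Q → ∀ x y : Q,
      (leftMul x)⁻¹ * k * leftMul x = (leftMul y)⁻¹ * k * leftMul y := by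
    intro k hk x y
    have hk' := isInvariant_dis _ (inv_mem (leftMul_mem x)) _ hk
    have := conj_eq _ hk' x y
    rw [inv_inv] at this
    have h2 : k = leftMul y * ((leftMul x)⁻¹ * k * leftMul x) * (leftMul y)⁻¹ := by
      rw [← this]; group
    conv_rhs => rw [h2]
    group
  -- Displacing the variables displaces the value of the term by some `g` that does not depend on
  -- the assignment `e`. For the term condition, displace `u` to `v`: the same `g` serves all
  -- parameter tuples, and one fixed point forces `g = 1`.
  have key : ∀ {X : Type} (t : QTerm X) (d : X → Equiv.Perm Q), (∀ i, d i ∈ Dis Q) →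
      ∃ g ∈ Dis Q, ∀ e : X → Q, t.eval (fun i => d i (e i)) = g (t.eval e) := by
    intro X t d hd
    induction t with
    | var x => exact ⟨d x, hd x, fun e => rfl⟩
    | act s t hs ht' =>
      obtain ⟨g, hg, h1⟩ := hs
      obtain ⟨h, hh, h2⟩ := ht'
      rcases isEmpty_or_nonempty Q with hQ | ⟨⟨o⟩⟩
      · exact ⟨1, one_mem _, fun e => (hQ.false (QTerm.eval e s)).elim⟩
      refine ⟨g * (leftMul o * (g⁻¹ * h) * (leftMul o)⁻¹),
        mul_mem hg (isInvariant_dis _ (leftMul_mem o) _ (mul_mem (inv_mem hg) hh)), fun e => ?_⟩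
      simp only [QTerm.eval, h1, h2]
      rw [conj_eq _ (mul_mem (inv_mem hg) hh) o (s.eval e)]
      change leftMul (g (s.eval e)) (h (t.eval e)) = (g * _) (leftMul (s.eval e) (t.eval e))
      rw [← conj_leftMul (dis_le_lMlt hg)]
      simp [-Rack.act'_apply]
    | invAct s t hs ht' =>
      obtain ⟨g, hg, h1⟩ := hs
      obtain ⟨h, hh, h2⟩ := ht'
      rcases isEmpty_or_nonempty Q with hQ | ⟨⟨o⟩⟩
      · exact ⟨1, one_mem _, fun e => (hQ.false (QTerm.eval e s)).elim⟩
      refine ⟨g * ((leftMul o)⁻¹ * (g⁻¹ * h) * leftMul o), mul_mem hg ?_, fun e => ?_⟩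
      · have := isInvariant_dis _ (inv_mem (leftMul_mem o)) _ (mul_mem (inv_mem hg) hh)
        rwa [inv_inv] at this
      simp only [QTerm.eval, h1, h2]
      rw [conj_eq' _ (mul_mem (inv_mem hg) hh) o (s.eval e)]
      change (leftMul (g (s.eval e)))⁻¹ (h (t.eval e)) = (g * _) ((leftMul (s.eval e))⁻¹ (t.eval e))
      rw [← conj_leftMul (dis_le_lMlt hg)]
      simp only [mul_inv_rev, inv_inv, Equiv.Perm.mul_apply, perm_apply_inv]
  intro m n t a b u v huv
  choose d hd hdu using fun i => ht (u i) (v i)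
  obtain ⟨g, hg, h⟩ := key t (Sum.elim (fun _ => 1) d) (by
    rintro (i | i)
    · exact one_mem _
    · exact hd i)
  have h' : ∀ c : Fin m → Q, t.eval (Sum.elim c v) = g (t.eval (Sum.elim c u)) := by
    intro c
    rw [← h]
    congr 1
    funext i
    rcases i with i | i
    · rfl
    · exact (hdu i).symm
  have := hs g hg _ ((h' a).symm.trans huv.symm)
  rw [h' b, this]
  rfl

end Basic

/-! ### Displacement groups of strictly simple quandles -/

section StrictlySimple

variable {R : Type*} [Quandle R]

theorem IsStrictlySimple.eq_univ (hR : IsStrictlySimple R) {S : Subquandle R}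
    (hS : S.carrier.Nontrivial) : S.carrier = Set.univ := by
  by_contra h
  exact hR S ⟨hS, h⟩

/-- In a strictly simple quandle, an element of `LMlt` with two fixed points is trivial. -/
theorem IsStrictlySimple.eq_one (hR : IsStrictlySimple R) {g : Equiv.Perm R} (hg : g ∈ LMlt R)
    {x y : R} (hxy : x ≠ y) (hx : g x = x) (hy : g y = y) : g = 1 := by
  have hle : Subgroup.zpowers g ≤ LMlt R := (Subgroup.zpowers_le).2 hg
  have hfix : ∀ z : R, g z = z → z ∈ (fixedSubquandle _ hle).carrier := by
    intro z hz
    have : Subgroup.zpowers g ≤ MulAction.stabilizer (Equiv.Perm R) z :=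
      (Subgroup.zpowers_le).2 hz
    exact fun k hk => this hk
  have h := hR.eq_univ (S := fixedSubquandle _ hle) ⟨x, hfix x hx, y, hfix y hy, hxy⟩
  ext z
  have hz : z ∈ (fixedSubquandle _ hle).carrier := h ▸ Set.mem_univ z
  exact hz g (Subgroup.mem_zpowers g)

theorem Congruence.exists_rel_of_ne_bot {α : Congruence R} (h : α ≠ ⊥) :
    ∃ a b, α.r a b ∧ a ≠ b := by
  by_contra! hc
  apply h
  ext a b
  exact ⟨fun hab => hc a b hab, fun hab => (show a = b from hab) ▸ α.iseqv.refl a⟩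

open Classical in
/-- For a transitive action on a finite set in which nontrivial elements have at most one fixed
point, the identity and the fixed-point-free elements are as many as the points. -/
theorem ncard_fixedPointFree {G X : Type*} [Group G] [MulAction G X] [Finite G] [Finite X]
    [Nonempty X] [MulAction.IsPretransitive G X]
    (h : ∀ g : G, ∀ x y : X, x ≠ y → g • x = x → g • y = y → g = 1) :
    {g : G | g = 1 ∨ ∀ x : X, g • x ≠ x}.ncard = Nat.card X := by
  have := Fintype.ofFinite G
  have := Fintype.ofFinite X
  have hB := MulAction.sum_card_fixedBy_eq_card_orbits_mul_card_group G X
  have h1 : Fintype.card (Quotient (MulAction.orbitRel G X)) = 1 := by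
    rw [Fintype.card_eq_one_iff]
    obtain ⟨x⟩ := ‹Nonempty X›
    refine ⟨Quotient.mk _ x, fun y => ?_⟩
    induction y using Quotient.inductionOn with
    | h y => exact Quotient.sound (MulAction.exists_smul_eq G x y)
  rw [h1, one_mul] at hB
  -- Summed over `G`, this pointwise identity combines with Burnside's count of fixed points (total
  -- `|G|`) to give the claim.
  have hp : ∀ g : G, Fintype.card (MulAction.fixedBy X g) +
      (if g = 1 ∨ ∀ x : X, g • x ≠ x then 1 else 0) =
      1 + if g = 1 then Fintype.card X else 0 := by
    intro g
    by_cases hg : g = 1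
    · subst hg
      have : MulAction.fixedBy X (1 : G) = Set.univ := by ext; simp
      simp only [true_or, if_true]
      rw [add_comm, ← Nat.card_eq_fintype_card, this, Nat.card_univ, Nat.card_eq_fintype_card]
    · by_cases hf : ∀ x : X, g • x ≠ x
      · have : IsEmpty (MulAction.fixedBy X g) := ⟨fun x => hf x.1 x.2⟩
        simp [hg, hf]
      · push Not at hf
        obtain ⟨x, hx⟩ := hf
        have : Fintype.card (MulAction.fixedBy X g) = 1 := by
          rw [Fintype.card_eq_one_iff]
          refine ⟨⟨x, hx⟩, fun y => ?_⟩
          by_contra hne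
          exact hg (h g y.1 x (fun e => hne (Subtype.ext e)) y.2 hx)
        have hf' : ¬ ∀ x : X, g • x ≠ x := fun hh => hh x hx
        simp [hg, this, hf']
  have hs := Finset.sum_congr (rfl : (Finset.univ : Finset G) = Finset.univ) (fun g _ => hp g)
  rw [Finset.sum_add_distrib, Finset.sum_add_distrib, hB] at hs
  simp only [Finset.sum_const, Finset.sum_ite_eq', Finset.mem_univ, if_true, smul_eq_mul,
    mul_one, Finset.card_univ, add_right_inj, Finset.sum_boole, Nat.cast_id] at hs
  rw [Set.ncard_eq_toFinset_card', Nat.card_eq_fintype_card, ← hs]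
  congr 1
  ext; simp

/-- The displacement group of a strictly simple quandle of prime power size is a regular
elementary abelian group. -/
theorem IsStrictlySimple.dis_regular [Finite R] {q n : ℕ} [Fact q.Prime]
    (hR : IsStrictlySimple R) (hcard : Nat.card R = q ^ n) (hn : n ≠ 0)
    (ht : ∀ a b : R, ∃ g ∈ Dis R, g a = b) :
    (∀ g ∈ Dis R, ∀ h ∈ Dis R, g * h = h * g) ∧ (∀ g ∈ Dis R, g ^ q = 1) ∧
      ∀ g ∈ Dis R, ∀ x, g x = x → g = 1 := by
  have hq : q.Prime := Fact.out
  have h1 : 1 < Nat.card R := hcard ▸ Nat.one_lt_pow hn hq.one_lt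
  have : Nontrivial R := Finite.one_lt_card_iff_nontrivial.1 h1
  have htr : MulAction.IsPretransitive (Dis R) R := ⟨fun a b => by
    obtain ⟨g, hg, h⟩ := ht a b
    exact ⟨⟨g, hg⟩, h⟩⟩
  have hfix : ∀ g : Dis R, ∀ x y : R, x ≠ y → g • x = x → g • y = y → g = 1 :=
    fun g x y hxy hx hy => Subtype.ext (hR.eq_one (dis_le_lMlt g.2) hxy hx hy)
  obtain ⟨P⟩ := (inferInstance : Nonempty (Sylow q (Dis R)))
  -- A nontrivial `g ∈ P` with a fixed point would have exactly one, giving `q ^ n ≡ 1` modulo `q`.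
  have hP : ∀ g ∈ P, ∀ x : R, g • x = x → g = 1 := by
    intro g hg x hx
    by_contra hne
    have hz : IsPGroup q (Subgroup.zpowers g) :=
      P.2.to_le ((Subgroup.zpowers_le).2 hg)
    have hmod := hz.card_modEq_card_fixedPoints R
    have hset : MulAction.fixedPoints (Subgroup.zpowers g) R = {x} := by
      ext y
      simp only [MulAction.mem_fixedPoints, Set.mem_singleton_iff]
      constructor
      · intro hy
        by_contra hyx
        exact hne (hfix g y x hyx (hy ⟨g, Subgroup.mem_zpowers g⟩) hx)
      · rintro rfl ⟨k, hk⟩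
        have : Subgroup.zpowers g ≤ MulAction.stabilizer (Dis R) y :=
          (Subgroup.zpowers_le).2 hx
        exact this hk
    rw [hset, hcard, Nat.card_unique] at hmod
    have h0 : q ^ n ≡ 0 [MOD q] := (Nat.modEq_zero_iff_dvd).2 (dvd_pow_self q hn)
    exact hq.one_lt.ne' (Nat.dvd_one.1 ((Nat.modEq_zero_iff_dvd).1 (hmod.symm.trans h0)))
  have a : R := Classical.arbitrary R
  have hPcard : Nat.card R ≤ Nat.card P := by
    rw [hcard]
    refine Nat.le_of_dvd Nat.card_pos (P.pow_dvd_card_of_pow_dvd_card ?_)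
    rw [← hcard, ← MulAction.index_stabilizer_of_transitive (Dis R) a]
    exact Subgroup.index_dvd_card _
  -- The Sylow subgroup lies in the set of fixed-point-free elements together with `1`, and is at
  -- least as large. This describes `P` by a conjugation-invariant property, so `P` is normalised by
  -- `LMlt(R)`; being transitive, it is all of `Dis(R)`.
  have hPset : (P : Set (Dis R)) = {g | g = 1 ∨ ∀ x : R, g • x ≠ x} := by
    apply Set.eq_of_subset_of_ncard_le
    · intro g hg
      by_cases h : ∀ x : R, g • x ≠ x
      · exact Or.inr h
      · push Not at h
        obtain ⟨x, hx⟩ := h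
        exact Or.inl (hP g hg x hx)
    · rw [ncard_fixedPointFree hfix]
      exact hPcard
    · exact Set.toFinite _
  have hPt : ∀ x y : R, ∃ g ∈ P, g • x = y := by
    intro x y
    have hinj : Function.Injective (fun g : P => (g : Dis R) • x) := by
      intro g h hgh
      have : (h : Dis R)⁻¹ * g = 1 :=
        hP _ (mul_mem (inv_mem h.2) g.2) x (by
          rw [mul_smul, inv_smul_eq_iff]; exact hgh)
      exact Subtype.ext (inv_mul_eq_one.1 this).symm
    obtain ⟨g, hg⟩ := (hinj.bijective_of_nat_card_le hPcard).2 y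
    exact ⟨g, g.2, hg⟩
  have hle : Dis R ≤ (P : Subgroup (Dis R)).map (Dis R).subtype := by
    apply dis_le_of_transitive
    · rintro _ ⟨g, _, rfl⟩
      exact dis_le_lMlt g.2
    · rintro h hh _ ⟨g, hg, rfl⟩
      refine ⟨⟨h * g * h⁻¹, isInvariant_dis h hh g g.2⟩, ?_, rfl⟩
      change _ ∈ (P : Set (Dis R))
      rw [hPset]
      have hg' : g ∈ (P : Set (Dis R)) := hg
      rw [hPset] at hg'
      rcases hg' with rfl | hg'
      · left; ext; simp
      · right
        intro x hx
        apply hg' (h⁻¹ x)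
        change (h * g * h⁻¹) x = x at hx
        change (g : Equiv.Perm R) (h⁻¹ x) = h⁻¹ x
        rw [Equiv.Perm.eq_inv_iff_eq]
        exact hx
    · intro x y
      obtain ⟨g, hg, h⟩ := hPt x y
      exact ⟨g, ⟨g, hg, rfl⟩, h⟩
  have hmem : ∀ g : Dis R, g ∈ P := by
    intro g
    obtain ⟨g', hg', he⟩ := hle g.2
    rwa [← Subtype.ext (a1 := g') (a2 := g) he]
  have hsemi : ∀ g ∈ Dis R, ∀ x, g x = x → g = 1 := fun g hg x hx =>
    congrArg Subtype.val (hP ⟨g, hg⟩ (hmem _) x hx)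
  have hpg : IsPGroup q (Dis R) := fun g => by
    obtain ⟨k, hk⟩ := P.2 ⟨g, hmem g⟩
    exact ⟨k, congrArg Subtype.val hk⟩
  have hne : Dis R ≠ ⊥ := by
    intro hb
    obtain ⟨b, hba⟩ := exists_ne a
    obtain ⟨g, hg, hgab⟩ := ht a b
    rw [hb, Subgroup.mem_bot] at hg
    rw [hg] at hgab
    exact hba hgab.symm
  -- The orbits of this nontrivial invariant subgroup are subquandles, so it is transitive by strict
  -- simplicity; a transitive subgroup of a semiregular group is the whole group.
  have hZ : Dis R ≤ omegaCenter q (Dis R) := by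
    have hZle : omegaCenter q (Dis R) ≤ LMlt R := (omegaCenter_le _ _).trans dis_le_lMlt
    have hi := isInvariant_dis.omegaCenter (Q := R) q
    obtain ⟨b, c, hbc, hne'⟩ := Congruence.exists_rel_of_ne_bot
      (orbitCon_ne_bot hZle hi (omegaCenter_ne_bot hpg hne))
    have huniv := hR.eq_univ (S := (orbitCon _ hZle hi).blockSubquandle b)
      ⟨b, (orbitCon _ hZle hi).iseqv.refl b, c, hbc, hne'⟩
    intro g hg
    have : g b ∈ ((orbitCon _ hZle hi).blockSubquandle b).carrier := huniv ▸ Set.mem_univ _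
    obtain ⟨z, hz, hzb⟩ := this
    have : z⁻¹ * g = 1 := hsemi _ (mul_mem (inv_mem hz.1) hg) b (by
      rw [Equiv.Perm.mul_apply, ← hzb, perm_inv_apply])
    rwa [← inv_mul_eq_one.1 this]
  exact ⟨fun g hg h hh => (hZ hh).2.1 g hg, fun g hg => (hZ hg).2.2, hsemi⟩

end StrictlySimple

/-! ### Extensions of elementary abelian groups of coprime orders -/

section Group

open scoped commutatorElement

theorem nonempty_linearEquiv_of_natCard {B : Type*} [AddCommGroup B] [Finite B] {p r : ℕ}
    [Fact p.Prime] [Module (ZMod p) B] (hcard : Nat.card B = p ^ r) :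
    Nonempty (B ≃ₗ[ZMod p] (Fin r → ZMod p)) := by
  have h := Module.natCard_eq_pow_finrank (K := ZMod p) (V := B)
  rw [hcard, Nat.card_zmod] at h
  have hr := Nat.pow_right_injective (Fact.out : p.Prime).two_le h
  exact ⟨LinearEquiv.ofFinrankEq B (Fin r → ZMod p) (by rw [← hr, Module.finrank_fin_fun])⟩

theorem nonempty_addEquiv_of_nsmul_eq_zero {B : Type*} [AddCommGroup B] [Finite B] {p r : ℕ}
    [Fact p.Prime] (hp : ∀ b : B, p • b = 0) (hcard : Nat.card B = p ^ r) :
    Nonempty (B ≃+ (Fin r → ZMod p)) := by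
  let : Module (ZMod p) B := AddCommGroup.zmodModule hp
  exact (nonempty_linearEquiv_of_natCard hcard).map LinearEquiv.toAddEquiv

theorem nonempty_mulEquiv_of_pow_eq_one {A : Type*} [Group A] [Finite A] {p r : ℕ}
    [Fact p.Prime] (hc : ∀ a b : A, a * b = b * a) (hp : ∀ a : A, a ^ p = 1)
    (hcard : Nat.card A = p ^ r) : Nonempty (A ≃* Multiplicative (Fin r → ZMod p)) := by
  let : CommGroup A := { ‹Group A› with mul_comm := hc }
  obtain ⟨e⟩ := nonempty_addEquiv_of_nsmul_eq_zero (B := Additive A)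
    (fun x => congrArg Additive.ofMul (hp x.toMul)) hcard
  exact ⟨AddEquiv.toMultiplicativeRight e⟩

variable {G : Type*} [Group G] {N : Subgroup G} {p q r n : ℕ}

/-- The structure of an extension of an elementary abelian `p`-group by an elementary abelian
`q`-group. -/
structure IsElementaryExtension (N : Subgroup G) (p q r n : ℕ) : Prop where
  normal : N.Normal
  comm : ∀ g ∈ N, ∀ h ∈ N, g * h = h * g
  pow : ∀ g ∈ N, g ^ p = 1
  card : Nat.card N = p ^ r
  index : N.index = q ^ n
  commutator_mem : ∀ g h : G, ⁅g, h⁆ ∈ N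
  pow_quotient_mem : ∀ g : G, g ^ q ∈ N

/-- Schur–Zassenhaus gives `H`; its commutators and `q`-th powers lie in `N ∩ H = 1`. -/
theorem IsElementaryExtension.exists_complement (hN : IsElementaryExtension N p q r n)
    (hp : p.Prime) (hq : q.Prime) (hpq : p ≠ q) :
    ∃ H : Subgroup G, N.IsComplement' H ∧ (∀ g ∈ H, ∀ h ∈ H, g * h = h * g) ∧
      ∀ h ∈ H, h ^ q = 1 := by
  have := hN.normal
  obtain ⟨H, hH⟩ := Subgroup.exists_right_complement'_of_coprime (N := N) (by
    rw [hN.card, hN.index]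
    exact Nat.Coprime.pow _ _ ((Nat.coprime_primes hp hq).2 hpq))
  refine ⟨H, hH, fun g hg h hh => ?_, fun h hh => ?_⟩
  · exact commutatorElement_eq_one_iff_mul_comm.1 (Subgroup.disjoint_def.1 hH.disjoint
      (hN.commutator_mem g h)
      (mul_mem (mul_mem (mul_mem hg hh) (inv_mem hg)) (inv_mem hh)))
  · exact Subgroup.disjoint_def.1 hH.disjoint (hN.pow_quotient_mem h) (pow_mem hh q)

theorem exists_mul_eq_of_isComplement' {H : Subgroup G} (hH : N.IsComplement' H) (g : G) :
    ∃ k ∈ N, ∃ h ∈ H, k * h = g := by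
  obtain ⟨⟨k, h⟩, hkh⟩ := hH.2 g
  exact ⟨k, k.2, h, h.2, hkh⟩

/-- If `[N, G] ≤ D` with `D` normal, then `[G, G] ≤ D`. -/
theorem IsElementaryExtension.commutator_mem_of (hN : IsElementaryExtension N p q r n)
    (hp : p.Prime) (hq : q.Prime) (hpq : p ≠ q) (D : Subgroup G) [D.Normal]
    (hD : ∀ k ∈ N, ∀ g : G, ⁅k, g⁆ ∈ D) (g h : G) : ⁅g, h⁆ ∈ D := by
  obtain ⟨H, hH, hc, -⟩ := hN.exists_complement hp hq hpq
  -- In `G ⧸ D` the image of `N` is central and that of `H` is commutative, so their product is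
  -- commutative.
  have hmem : ∀ x y : G, ⁅x, y⁆ ∈ D ↔ Commute (x : G ⧸ D) (y : G ⧸ D) := by
    intro x y
    rw [← QuotientGroup.eq_one_iff, ← commutatorElement_eq_one_iff_commute]
    rfl
  simp only [hmem] at hD ⊢
  obtain ⟨k, hk, x, hx, rfl⟩ := exists_mul_eq_of_isComplement' hH g
  obtain ⟨l, hl, y, hy, rfl⟩ := exists_mul_eq_of_isComplement' hH h
  refine Commute.mul_left (hD k hk (l * y))
    (Commute.mul_right (b := (l : G ⧸ D)) (c := (y : G ⧸ D)) (hD l hl x).symm ?_)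
  rw [Commute, SemiconjBy, ← QuotientGroup.mk_mul, ← QuotientGroup.mk_mul, hc x hx y hy]

/-- If the derived subgroup of `G` is central, then `G` is commutative. -/
theorem IsElementaryExtension.comm_of_commutator_central (hN : IsElementaryExtension N p q r n)
    (hp : p.Prime) (hq : q.Prime) (hpq : p ≠ q) (hz : ∀ x y g : G, ⁅x, y⁆ * g = g * ⁅x, y⁆)
    (g h : G) : g * h = h * g := by
  obtain ⟨H, hH, -, hHq⟩ := hN.exists_complement hp hq hpq
  have hcop : p.Coprime q := (Nat.coprime_primes hp hq).2 hpq
  -- With `c = ⁅k, x⁆` central, the `q`-th power of `k x k⁻¹ = c x` gives `c ^ q = 1`; also `c ^ p =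
  -- 1` because `c ∈ N`.
  have key : ∀ k ∈ N, ∀ x ∈ H, Commute k x := by
    intro k hk x hx
    have hconj : k * x * k⁻¹ = ⁅k, x⁆ * x := by rw [commutatorElement_def]; group
    have hpow := congrArg (· ^ q) hconj
    simp only [conj_pow, (show Commute ⁅k, x⁆ x from hz k x x).mul_pow, hHq x hx, mul_one,
      mul_inv_cancel] at hpow
    have hpow' := hN.pow _ (hN.commutator_mem k x)
    have : orderOf ⁅k, x⁆ ∣ 1 := by
      rw [← hcop]
      exact Nat.dvd_gcd (orderOf_dvd_of_pow_eq_one hpow') (orderOf_dvd_of_pow_eq_one hpow.symm)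
    rw [Nat.dvd_one, orderOf_eq_one_iff] at this
    exact commutatorElement_eq_one_iff_commute.1 this
  refine commutatorElement_eq_one_iff_mul_comm.1 ?_
  rw [← Subgroup.mem_bot]
  refine hN.commutator_mem_of hp hq hpq ⊥ (fun k hk g => ?_) g h
  obtain ⟨l, hl, y, hy, rfl⟩ := exists_mul_eq_of_isComplement' hH g
  rw [Subgroup.mem_bot, commutatorElement_eq_one_iff_commute]
  exact Commute.mul_right (hN.comm k hk l hl) (key k hk y hy)

/-- An element of the complement acting trivially on `N` also commutes with the commutative
complement, hence is central of order dividing `q`; `hf` excludes this, so the action is faithful.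
-/
theorem IsElementaryExtension.exists_semidirectProduct [Finite G]
    (hN : IsElementaryExtension N p q r n) (hp : p.Prime) (hq : q.Prime) (hpq : p ≠ q)
    (hf : ∀ g : G, g ^ q = 1 → (∀ h, h * g = g * h) → g = 1) :
    ∃ ρ : Multiplicative (Fin n → ZMod q) →* MulAut (Multiplicative (Fin r → ZMod p)),
      Function.Injective ρ ∧
      Nonempty (G ≃* Multiplicative (Fin r → ZMod p) ⋊[ρ] Multiplicative (Fin n → ZMod q)) := by
  have := hN.normal
  have := Fact.mk hp
  have := Fact.mk hq
  obtain ⟨H, hH, hHc, hHq⟩ := hN.exists_complement hp hq hpq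
  obtain ⟨e⟩ := nonempty_mulEquiv_of_pow_eq_one (A := N) (p := p) (r := r)
    (fun a b => Subtype.ext (hN.comm a a.2 b b.2)) (fun a => Subtype.ext (hN.pow a a.2)) hN.card
  obtain ⟨f⟩ := nonempty_mulEquiv_of_pow_eq_one (A := H) (p := q) (r := n)
    (fun a b => Subtype.ext (hHc a a.2 b b.2)) (fun a => Subtype.ext (hHq a a.2))
    (by rw [← hN.index, hH.symm.index_eq_card])
  refine ⟨_, ?_, ⟨(SemidirectProduct.mulEquivSubgroup hH).symm.trans
    (SemidirectProduct.congr' e f)⟩⟩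
  rw [injective_iff_map_eq_one]
  intro x hx
  suffices f.symm x = 1 by simpa using this
  apply Subtype.ext
  refine hf _ (hHq _ (f.symm x).2) fun h => ?_
  obtain ⟨k, hk, y, hy, rfl⟩ := exists_mul_eq_of_isComplement' hH h
  have h1 := DFunLike.congr_fun hx (e ⟨k, hk⟩)
  have h2 := congrArg (fun z => ((e.symm z : N) : G)) h1
  simp at h2
  have h3 : k * (f.symm x : G) = f.symm x * k := by
    exact (mul_inv_eq_iff_eq_mul.1 h2).symm
  rw [mul_assoc, hHc y hy _ (f.symm x).2, ← mul_assoc, h3, mul_assoc]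

end Group

/-! ### The factor by `α` and the kernel of `Dis(Q)` acting on it -/

section Kernel

open scoped commutatorElement

variable {Q : Type*} [Quandle Q] {α : Congruence Q} {p q m n : ℕ}

theorem Congruence.eq_top_of_forall {β : Congruence Q} (h : ∀ a b, β.r a b) : β = ⊤ := by
  ext a b
  exact ⟨fun _ => trivial, fun _ => h a b⟩

theorem Congruence.exists_not_rel_of_ne_top {β : Congruence Q} (h : β ≠ ⊤) :
    ∃ a b, ¬ β.r a b := by
  by_contra! hc
  exact h (Congruence.eq_top_of_forall hc)

/-- In a locally strictly simple quandle, a subquandle properly containing a nontrivial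
subquandle is everything. -/
theorem IsLocallyStrictlySimple.eq_univ (hQ : IsLocallyStrictlySimple Q) {S T : Subquandle Q}
    (hT : T.carrier.Nontrivial) (hTS : T.carrier ⊂ S.carrier) : S.carrier = Set.univ := by
  by_contra h
  let U : Subquandle S.carrier :=
    { carrier := {x | x.1 ∈ T.carrier}
      act_mem := fun ha hb => T.act_mem ha hb
      invAct_mem := fun ha hb => T.invAct_mem ha hb }
  refine hQ S ⟨hT.mono hTS.subset, h⟩ U ⟨?_, fun hU => ?_⟩
  · obtain ⟨x, hx, y, hy, hxy⟩ := hT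
    exact ⟨⟨x, hTS.subset hx⟩, hx, ⟨y, hTS.subset hy⟩, hy, fun e => hxy (congrArg Subtype.val e)⟩
  · obtain ⟨x, hx, hxT⟩ := Set.exists_of_ssubset hTS
    exact hxT (show (⟨x, hx⟩ : S.carrier) ∈ U.carrier from hU ▸ Set.mem_univ _)

/-- The preimage of a subquandle with at least two points strictly contains a block, itself a
nontrivial subquandle, so the LSS property makes it everything. -/
theorem isStrictlySimple_factor (hQ : IsLocallyStrictlySimple Q)
    (hα : ∀ a, (α.block a).Nontrivial) : IsStrictlySimple α.Factor := by
  rintro S ⟨⟨x, hx, y, hy, hxy⟩, hS⟩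
  let T : Subquandle Q :=
    { carrier := {a | (Quotient.mk α.toSetoid a : α.Factor) ∈ S.carrier}
      act_mem := fun ha hb => S.act_mem ha hb
      invAct_mem := fun ha hb => S.invAct_mem ha hb }
  induction x using Quotient.inductionOn with | h x
  induction y using Quotient.inductionOn with | h y
  have hT : T.carrier = Set.univ := by
    refine hQ.eq_univ (T := α.blockSubquandle x) (hα x) (Set.ssubset_iff_subset_ne.2 ⟨?_, ?_⟩)
    · intro z hz
      have : (Quotient.mk α.toSetoid x : α.Factor) = Quotient.mk α.toSetoid z :=
        Quotient.sound hz
      change Quotient.mk α.toSetoid z ∈ S.carrier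
      rwa [← this]
    · intro he
      have : y ∈ (α.blockSubquandle x).carrier := he ▸ hy
      exact hxy (Quotient.sound this)
  apply hS
  ext z
  induction z using Quotient.inductionOn with | h z
  exact ⟨fun _ => trivial, fun _ => show z ∈ T.carrier from hT ▸ Set.mem_univ _⟩

theorem exists_mem_dis_factor (α : Congruence Q) {g : Equiv.Perm Q} (hg : g ∈ Dis Q) :
    ∃ g' ∈ Dis α.Factor, ∀ x, g' (Quotient.mk α.toSetoid x) = Quotient.mk α.toSetoid (g x) := by
  induction hg using Subgroup.closure_induction with
  | mem g hg =>
    obtain ⟨a, b, rfl⟩ := hg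
    exact ⟨_, mul_inv_mem_dis (Quotient.mk α.toSetoid a) (Quotient.mk α.toSetoid b), fun x => rfl⟩
  | one => exact ⟨1, one_mem _, fun x => rfl⟩
  | mul g h _ _ hg hh =>
    obtain ⟨g', hg', h1⟩ := hg
    obtain ⟨h', hh', h2⟩ := hh
    exact ⟨g' * h', mul_mem hg' hh', fun x => by
      rw [Equiv.Perm.mul_apply, h2, h1, Equiv.Perm.mul_apply]⟩
  | inv g _ hg =>
    obtain ⟨g', hg', h1⟩ := hg
    exact ⟨g'⁻¹, inv_mem hg', fun x => by
      rw [Equiv.Perm.inv_eq_iff_eq, h1, perm_apply_inv]⟩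

/-- The kernel of the action of `Dis(Q)` on the factor by `α`. -/
def kerDis (α : Congruence Q) : Subgroup (Equiv.Perm Q) where
  carrier := {g | g ∈ Dis Q ∧ ∀ x, α.r (g x) x}
  one_mem' := ⟨one_mem _, fun x => α.iseqv.refl x⟩
  mul_mem' := fun ⟨hg, hg'⟩ ⟨hh, hh'⟩ =>
    ⟨mul_mem hg hh, fun x => α.iseqv.trans (hg' _) (hh' x)⟩
  inv_mem' := by
    rintro g ⟨hg, hg'⟩
    refine ⟨inv_mem hg, fun x => ?_⟩
    have := α.iseqv.symm (hg' (g⁻¹ x))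
    rwa [perm_apply_inv] at this

theorem kerDis_le (α : Congruence Q) : kerDis α ≤ Dis Q := fun _ h => h.1

theorem isInvariant_kerDis (α : Congruence Q) : IsInvariant (kerDis α) := by
  rintro h hh g ⟨hg, hg'⟩
  refine ⟨isInvariant_dis h hh g hg, fun x => ?_⟩
  have := (α.rel_apply_iff hh).2 (hg' (h⁻¹ x))
  rwa [perm_apply_inv] at this

/-- The displacement group of the factor by `α` is a regular elementary abelian `q`-group, in
terms of the action of `Dis(Q)`. -/
structure HasRegularFactor (α : Congruence Q) (q : ℕ) : Prop where
  isAbelian : IsAbelian α.Factor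
  commutator_mem : ∀ g ∈ Dis Q, ∀ h ∈ Dis Q, ⁅g, h⁆ ∈ kerDis α
  pow_mem_kerDis : ∀ g ∈ Dis Q, g ^ q ∈ kerDis α
  mem : ∀ g ∈ Dis Q, ∀ x, α.r (g x) x → g ∈ kerDis α

theorem hasRegularFactor [Finite Q] (hq : q.Prime) (hQ : IsLocallyStrictlySimple Q)
    (ht : ∀ a b : Q, ∃ g ∈ Dis Q, g a = b) (hα : ∀ a, (α.block a).Nontrivial)
    (hcard : Nat.card α.Factor = q ^ n) (hn : n ≠ 0) : HasRegularFactor α q := by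
  have := Fact.mk hq
  have ht' : ∀ a b : α.Factor, ∃ g ∈ Dis α.Factor, g a = b := by
    intro a b
    induction a using Quotient.inductionOn with | h a
    induction b using Quotient.inductionOn with | h b
    obtain ⟨g, hg, rfl⟩ := ht a b
    obtain ⟨g', hg', h⟩ := exists_mem_dis_factor α hg
    exact ⟨g', hg', h a⟩
  obtain ⟨hc, hp, hs⟩ := (isStrictlySimple_factor hQ hα).dis_regular hcard hn ht'
  refine ⟨isAbelian_of_dis hc ht', fun g hg h hh => ?_, fun g hg => ?_, fun g hg x hx => ?_⟩
  · obtain ⟨g', hg', h1⟩ := exists_mem_dis_factor α hg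
    obtain ⟨h', hh', h2⟩ := exists_mem_dis_factor α hh
    refine ⟨mul_mem (mul_mem (mul_mem hg hh) (inv_mem hg)) (inv_mem hh), fun x => ?_⟩
    obtain ⟨y, rfl⟩ : ∃ y, x = (h * g) y := ⟨(h * g)⁻¹ x, (perm_apply_inv _ _).symm⟩
    apply Quotient.exact
    have : ⁅g, h⁆ ((h * g) y) = g (h y) := by
      rw [← Equiv.Perm.mul_apply, commutatorElement_def,
        show g * h * g⁻¹ * h⁻¹ * (h * g) = g * h by group]; rfl
    rw [this, Equiv.Perm.mul_apply]
    rw [← h1, ← h2, ← h2, ← h1]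
    exact DFunLike.congr_fun (hc g' hg' h' hh') (Quotient.mk α.toSetoid y)
  · obtain ⟨g', hg', h1⟩ := exists_mem_dis_factor α hg
    refine ⟨pow_mem hg q, fun x => Quotient.exact ?_⟩
    have : ∀ k : ℕ, (g' ^ k) (Quotient.mk α.toSetoid x) = Quotient.mk α.toSetoid ((g ^ k) x) := by
      intro k
      induction k with
      | zero => rfl
      | succ k ih => rw [pow_succ', pow_succ', Equiv.Perm.mul_apply, ih, h1]; rfl
    rw [← this, hp g' hg']
    rfl
  · obtain ⟨g', hg', h1⟩ := exists_mem_dis_factor α hg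
    have := hs g' hg' (Quotient.mk α.toSetoid x) ((h1 x).trans (Quotient.sound hx))
    refine ⟨hg, fun y => Quotient.exact ?_⟩
    rw [← h1, this]
    rfl

/-- `γ_Q` is not `0_Q` because `Q` is not abelian, and not `1_Q` because it lies below `α`. -/
theorem gammaCon_eq (hA : IsAbelian α.Factor) (hna : ¬ IsAbelian Q) (htop : α ≠ ⊤)
    (huniq : ∀ β : Congruence Q, β ≠ ⊥ → β ≠ ⊤ → β = α) : gammaCon Q = α := by
  apply huniq
  · intro hb
    have := isAbelian_factor_gammaCon Q
    rw [hb, isAbelian_factor_iff] at this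
    exact hna this
  · intro hb
    apply htop
    apply Congruence.eq_top_of_forall
    intro a b
    have : (gammaCon Q).r a b := by rw [hb]; trivial
    exact this α hA

/-- Orbits of nontrivial invariant subgroups contain the blocks of the unique proper congruence. -/
theorem exists_mem_of_rel (huniq : ∀ β : Congruence Q, β ≠ ⊥ → β ≠ ⊤ → β = α)
    {N : Subgroup (Equiv.Perm Q)} (hN : N ≤ LMlt Q) (hi : IsInvariant N) (hne : N ≠ ⊥) {a b : Q}
    (hab : α.r a b) : ∃ g ∈ N, g a = b := by
  change (orbitCon N hN hi).r a b
  by_cases h : orbitCon N hN hi = ⊤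
  · rw [h]; trivial
  · rwa [huniq _ (orbitCon_ne_bot hN hi hne) h]

theorem HasRegularFactor.exists_mem_kerDis (hα : HasRegularFactor α q)
    (ht : ∀ a b : Q, ∃ g ∈ Dis Q, g a = b) {a b : Q} (hab : α.r a b) :
    ∃ g ∈ kerDis α, g a = b := by
  obtain ⟨g, hg, rfl⟩ := ht a b
  exact ⟨g, hα.mem g hg a (α.iseqv.symm hab), rfl⟩

theorem HasRegularFactor.orbit_kerDis (hα : HasRegularFactor α q)
    (ht : ∀ a b : Q, ∃ g ∈ Dis Q, g a = b) (a : Q) :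
    MulAction.orbit (kerDis α) a = α.block a := by
  ext b
  constructor
  · rintro ⟨g, rfl⟩
    exact α.iseqv.symm (g.2.2 a)
  · intro hb
    obtain ⟨g, hg, hgb⟩ := hα.exists_mem_kerDis ht hb
    exact ⟨⟨g, hg⟩, hgb⟩

/-- The kernel preserves blocks, on which stabilizers are constant, so each stabilizer in the kernel
is normal; its index is the block size. -/
theorem HasRegularFactor.pow_card_block [Finite Q] (hα : HasRegularFactor α q)
    (ht : ∀ a b : Q, ∃ g ∈ Dis Q, g a = b)
    (hσ : ∀ a b, α.r a b → ∀ g ∈ Dis Q, g a = a → g b = b) {M : ℕ}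
    (hM : ∀ a, Nat.card (α.block a) = M) {g : Equiv.Perm Q} (hg : g ∈ kerDis α) : g ^ M = 1 := by
  ext a
  have hn : (MulAction.stabilizer (kerDis α) a).Normal := by
    refine ⟨fun k hk l => ?_⟩
    have := hσ a ((l⁻¹ : Equiv.Perm Q) a) (α.iseqv.symm ((inv_mem l.2).2 a)) k k.2.1 hk
    change (l : Equiv.Perm Q) ((k : Equiv.Perm Q) ((l⁻¹ : Equiv.Perm Q) a)) = a
    rw [this, perm_apply_inv]
  have hidx : (MulAction.stabilizer (kerDis α) a).index = M := by
    rw [MulAction.index_stabilizer, hα.orbit_kerDis ht]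
    exact hM a
  have := (MulAction.stabilizer (kerDis α) a).pow_index_mem ⟨g, hg⟩
  rw [hidx] at this
  exact this

theorem HasRegularFactor.kerDis_comm [Finite Q] (hα : HasRegularFactor α q) (hp : p.Prime)
    (ht : ∀ a b : Q, ∃ g ∈ Dis Q, g a = b)
    (hσ : ∀ a b, α.r a b → ∀ g ∈ Dis Q, g a = a → g b = b)
    (hM : ∀ a, Nat.card (α.block a) = p ^ m)
    (huniq : ∀ β : Congruence Q, β ≠ ⊥ → β ≠ ⊤ → β = α) (hbot : α ≠ ⊥) :
    (∀ g ∈ kerDis α, ∀ h ∈ kerDis α, g * h = h * g) ∧ ∀ g ∈ kerDis α, g ^ p = 1 := by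
  have := Fact.mk hp
  have hpg : IsPGroup p (kerDis α) := fun g =>
    ⟨m, Subtype.ext (hα.pow_card_block ht hσ hM g.2)⟩
  have hne : kerDis α ≠ ⊥ := by
    obtain ⟨a, b, hab, hne⟩ := Congruence.exists_rel_of_ne_bot hbot
    obtain ⟨g, hg, hgab⟩ := hα.exists_mem_kerDis ht hab
    intro hb
    rw [hb, Subgroup.mem_bot] at hg
    rw [hg] at hgab
    exact hne hgab
  -- The central elements of order dividing `p` are transitive on blocks, so `g` agrees at `a` with
  -- one of them, `z`. The remainder `s` fixes the whole block of `a` by `hσ`, so on that block the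
  -- kernel acts through such `z`.
  have hdec : ∀ g ∈ kerDis α, ∀ a, ∃ z ∈ omegaCenter p (kerDis α), ∃ s ∈ kerDis α,
      s a = a ∧ g = z * s := by
    intro g hg a
    obtain ⟨z, hz, hza⟩ := exists_mem_of_rel huniq
      ((omegaCenter_le p _).trans ((kerDis_le α).trans dis_le_lMlt))
      ((isInvariant_kerDis α).omegaCenter p) (omegaCenter_ne_bot hpg hne)
      (α.iseqv.symm (hg.2 a))
    refine ⟨z, hz, z⁻¹ * g, mul_mem (inv_mem hz.1) hg, ?_, by group⟩
    rw [Equiv.Perm.mul_apply, ← hza, perm_inv_apply]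
  have hfix : ∀ s ∈ kerDis α, ∀ a, s a = a → ∀ z ∈ kerDis α, s (z a) = z a :=
    fun s hs a hsa z hz => hσ a (z a) (α.iseqv.symm (hz.2 a)) s hs.1 hsa
  refine ⟨fun g hg h hh => ?_, fun g hg => ?_⟩
  · ext a
    obtain ⟨z, hz, s, hs, hsa, rfl⟩ := hdec g hg a
    obtain ⟨w, hw, t, ht', hta, rfl⟩ := hdec h hh a
    simp only [Equiv.Perm.mul_apply, hsa, hta, hfix s hs a hsa w hw.1, hfix t ht' a hta z hz.1]
    exact DFunLike.congr_fun (hw.2.1 z hz.1) a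
  · ext a
    obtain ⟨z, hz, s, hs, hsa, rfl⟩ := hdec g hg a
    have : s ∈ MulAction.stabilizer (Equiv.Perm Q) a := hsa
    rw [(show Commute s z from hz.2.1 s hs).symm.mul_pow, hz.2.2, one_mul]
    exact pow_mem this p

/-- In a locally strictly simple quandle, stabilizers of points in different blocks intersect
trivially. -/
theorem eq_one_of_fixes (hQ : IsLocallyStrictlySimple Q) (hα : ∀ a, (α.block a).Nontrivial)
    (hσ : ∀ a b, α.r a b → ∀ g ∈ Dis Q, g a = a → g b = b) {g : Equiv.Perm Q} (hg : g ∈ Dis Q)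
    {a b : Q} (hab : ¬ α.r a b) (ha : g a = a) (hb : g b = b) : g = 1 := by
  have hle : Subgroup.zpowers g ≤ LMlt Q := (Subgroup.zpowers_le).2 (dis_le_lMlt hg)
  have hfix : ∀ z : Q, g z = z → z ∈ (fixedSubquandle _ hle).carrier := by
    intro z hz
    have : Subgroup.zpowers g ≤ MulAction.stabilizer (Equiv.Perm Q) z :=
      (Subgroup.zpowers_le).2 hz
    exact fun k hk => this hk
  -- The fixed points of `g` contain the block of `a` and the point `b` outside it.
  have h := hQ.eq_univ (S := fixedSubquandle _ hle) (T := α.blockSubquandle a) (hα a)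
    ((Set.ssubset_iff_of_subset fun c hc => hfix c (hσ a c hc g hg ha)).2 ⟨b, hfix b hb, hab⟩)
  ext z
  have hz : z ∈ (fixedSubquandle _ hle).carrier := h ▸ Set.mem_univ z
  exact hz g (Subgroup.mem_zpowers g)

end Kernel

/-! ### Order of the kernel, lower central series, and central elements of `Dis(Q)` -/

section Main

open scoped commutatorElement

variable {Q : Type*} [Quandle Q] {α : Congruence Q} {p q m n r : ℕ}

theorem HasRegularFactor.index_kerDis (hα : HasRegularFactor α q)
    (ht : ∀ a b : Q, ∃ g ∈ Dis Q, g a = b) [Nonempty Q] :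
    ((kerDis α).subgroupOf (Dis Q)).index = Nat.card α.Factor := by
  obtain ⟨a⟩ := ‹Nonempty Q›
  let f : Dis Q → α.Factor := fun g => Quotient.mk α.toSetoid (g.1 a)
  have hf : Function.Surjective f := by
    intro b
    induction b using Quotient.inductionOn with | h b
    obtain ⟨g, hg, rfl⟩ := ht a b
    exact ⟨⟨g, hg⟩, rfl⟩
  rw [← Nat.card_congr (Setoid.quotientKerEquivOfSurjective f hf)]
  refine Nat.card_congr (Quotient.congrRight fun g h => ?_)
  rw [QuotientGroup.leftRel_apply]
  change (g.1⁻¹ * h.1) ∈ kerDis α ↔ f g = f h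
  have key : f g = f h ↔ α.r ((g.1⁻¹ * h.1) a) a := by
    rw [← α.rel_apply_iff (dis_le_lMlt g.2), Equiv.Perm.mul_apply, perm_apply_inv]
    exact ⟨fun e => α.iseqv.symm (Quotient.exact e), fun e => Quotient.sound (α.iseqv.symm e)⟩
  rw [key]
  exact ⟨fun hk => hk.2 a, hα.mem _ (mul_mem (inv_mem g.2) h.2) a⟩

/-- A block is an orbit, so `p ^ m` divides the order; evaluation at two points in different blocks
is injective by `hsep`, so the order is at most `p ^ (2 * m)`. -/
theorem HasRegularFactor.exists_card_kerDis [Finite Q] (hα : HasRegularFactor α q) (hp : p.Prime)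
    (ht : ∀ a b : Q, ∃ g ∈ Dis Q, g a = b)
    (hexp : ∀ g ∈ kerDis α, g ^ p = 1)
    (hM : ∀ a, Nat.card (α.block a) = p ^ m) (htop : α ≠ ⊤)
    (hsep : ∀ g ∈ Dis Q, ∀ a b, ¬ α.r a b → g a = a → g b = b → g = 1) :
    ∃ k ≤ m, Nat.card (kerDis α) = p ^ (m + k) := by
  have := Fact.mk hp
  have hpg : IsPGroup p (kerDis α) := fun g => ⟨1, Subtype.ext (by simpa using hexp g g.2)⟩
  obtain ⟨r, hr⟩ := IsPGroup.iff_card.1 hpg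
  obtain ⟨a, b, hab⟩ := Congruence.exists_not_rel_of_ne_top htop
  have h1 : p ^ m ∣ p ^ r := by
    rw [← hr, ← hM a, ← hα.orbit_kerDis ht]
    have := MulAction.index_stabilizer (kerDis α) a
    change _ = Nat.card _ at this
    rw [← this]
    exact Subgroup.index_dvd_card _
  have h2 : p ^ r ≤ p ^ (m + m) := by
    let f : kerDis α → α.block a × α.block b := fun g =>
      (⟨g.1 a, α.iseqv.symm (g.2.2 a)⟩, ⟨g.1 b, α.iseqv.symm (g.2.2 b)⟩)
    have hf : Function.Injective f := by
      intro g h hgh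
      have ha : g.1 a = h.1 a := congrArg (fun x => (x.1 : Q)) hgh
      have hb : g.1 b = h.1 b := congrArg (fun x => (x.2 : Q)) hgh
      have := hsep (h.1⁻¹ * g.1) (mul_mem (inv_mem h.2.1) g.2.1) a b hab
        (by rw [Equiv.Perm.mul_apply, ha, perm_inv_apply])
        (by rw [Equiv.Perm.mul_apply, hb, perm_inv_apply])
      exact Subtype.ext (inv_mul_eq_one.1 this).symm
    have := Nat.card_le_card_of_injective f hf
    rwa [Nat.card_prod, hM, hM, hr, ← pow_add] at this
  have h1' := (Nat.pow_dvd_pow_iff_le_right hp.one_lt).1 h1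
  have h2' := (Nat.pow_le_pow_iff_right hp.one_lt).1 h2
  exact ⟨r - m, by omega, by rw [hr]; congr 1; omega⟩

theorem HasRegularFactor.isElementaryExtension [Nonempty Q] (hα : HasRegularFactor α q)
    (ht : ∀ a b : Q, ∃ g ∈ Dis Q, g a = b)
    (hcomm : ∀ g ∈ kerDis α, ∀ h ∈ kerDis α, g * h = h * g)
    (hexp : ∀ g ∈ kerDis α, g ^ p = 1) (hr : Nat.card (kerDis α) = p ^ r)
    (hn : Nat.card α.Factor = q ^ n) :
    IsElementaryExtension ((kerDis α).subgroupOf (Dis Q)) p q r n where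
  normal := ⟨fun k hk g => isInvariant_kerDis α g (dis_le_lMlt g.2) k hk⟩
  comm g hg h hh := Subtype.ext (hcomm g hg h hh)
  pow g hg := Subtype.ext (hexp g hg)
  card := by
    rw [← hr]
    exact Nat.card_congr (Subgroup.subgroupOfEquivOfLe (kerDis_le α)).toEquiv
  index := by rw [hα.index_kerDis ht, hn]
  commutator_mem g h := hα.commutator_mem g g.2 h h.2
  pow_quotient_mem g := hα.pow_mem_kerDis g g.2

theorem not_comm_dis (hna : ¬ IsAbelian Q) (ht : ∀ a b : Q, ∃ g ∈ Dis Q, g a = b) :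
    ¬ ∀ g ∈ Dis Q, ∀ h ∈ Dis Q, g * h = h * g :=
  fun h => hna (isAbelian_of_dis h ht)

theorem lowerCentralSeries_dis
    (hN : IsElementaryExtension ((kerDis α).subgroupOf (Dis Q)) p q r n)
    (hp : p.Prime) (hq : q.Prime) (hpq : p ≠ q) (hna : ¬ IsAbelian Q)
    (ht : ∀ a b : Q, ∃ g ∈ Dis Q, g a = b)
    (huniq : ∀ β : Congruence Q, β ≠ ⊥ → β ≠ ⊤ → β = α) :
    (Dis Q).lowerCentralSeries 1 = relDis α ∧ (Dis Q).lowerCentralSeries 2 = relDis α := by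
  -- `lowerCentralSeries` starts with the group itself at index `0`, so indices `1` and `2` match
  -- `γ_1` and `γ_2`.
  change ⁅Dis Q, Dis Q⁆ = relDis α ∧ ⁅⁅Dis Q, Dis Q⁆, Dis Q⁆ = relDis α
  have hE : ⁅Dis Q, Dis Q⁆ ≤ relDis α := by
    rw [Subgroup.commutator_le]
    intro g hg h hh
    have : ((relDis α).subgroupOf (Dis Q)).Normal :=
      ⟨fun k hk g => isInvariant_relDis α g (dis_le_lMlt g.2) k hk⟩
    refine hN.commutator_mem_of hp hq hpq ((relDis α).subgroupOf (Dis Q)) ?_ ⟨g, hg⟩ ⟨h, hh⟩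
    rintro ⟨k, hkd⟩ ⟨-, hk⟩ ⟨g, hg⟩
    change k * g * k⁻¹ * g⁻¹ ∈ relDis α
    -- Enlarging the range of `g` to `LMlt(Q)` allows induction on single generators: `⁅k, L_a⁆ =
    -- L_{k a} L_a⁻¹`, and `k a` is `α`-related to `a`.
    suffices ∀ g ∈ LMlt Q, ⁅k, g⁆ ∈ relDis α from this g (dis_le_lMlt hg)
    intro g hg
    induction hg using Subgroup.closure_induction with
    | mem g hg =>
      obtain ⟨a, rfl⟩ := hg
      rw [commutatorElement_def, conj_leftMul (dis_le_lMlt hkd)]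
      exact Subgroup.subset_closure ⟨_, _, hk a, rfl⟩
    | one => simp
    | mul x y hx _ h1 h2 =>
      have := mul_mem h1 (isInvariant_relDis α x hx _ h2)
      rwa [show ⁅k, x⁆ * (x * ⁅k, y⁆ * x⁻¹) = ⁅k, x * y⁆ by
        simp only [commutatorElement_def]; group] at this
    | inv x hx h1 =>
      have := isInvariant_relDis α _ (inv_mem hx) _ (inv_mem h1)
      rwa [show x⁻¹ * ⁅k, x⁆⁻¹ * x⁻¹⁻¹ = ⁅k, x⁻¹⁆ by
        simp only [commutatorElement_def]; group] at this
  have hle : ⁅Dis Q, Dis Q⁆ ≤ Dis Q := Subgroup.commutator_le.2 fun g hg h hh =>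
    mul_mem (mul_mem (mul_mem hg hh) (inv_mem hg)) (inv_mem hh)
  have hFE : ⁅⁅Dis Q, Dis Q⁆, Dis Q⁆ ≤ ⁅Dis Q, Dis Q⁆ := Subgroup.commutator_mono hle le_rfl
  -- Otherwise commutators are central, coprimality makes `Dis(Q)` commutative, and `Q` would be
  -- abelian.
  have hF : ⁅⁅Dis Q, Dis Q⁆, Dis Q⁆ ≠ ⊥ := by
    intro hb
    refine not_comm_dis hna ht fun g hg h hh => ?_
    refine congrArg Subtype.val
      (hN.comm_of_commutator_central hp hq hpq (fun x y z => ?_) ⟨g, hg⟩ ⟨h, hh⟩)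
    apply Subtype.ext
    have : ⁅⁅(x : Equiv.Perm Q), (y : Equiv.Perm Q)⁆, (z : Equiv.Perm Q)⁆ ∈
        ⁅⁅Dis Q, Dis Q⁆, Dis Q⁆ :=
      Subgroup.commutator_mem_commutator (Subgroup.commutator_mem_commutator x.2 y.2) z.2
    rw [hb, Subgroup.mem_bot, commutatorElement_eq_one_iff_mul_comm] at this
    exact this
  have hi : IsInvariant ⁅⁅Dis Q, Dis Q⁆, Dis Q⁆ :=
    (isInvariant_dis.commutator isInvariant_dis).commutator isInvariant_dis
  have hl : ⁅⁅Dis Q, Dis Q⁆, Dis Q⁆ ≤ LMlt Q := hFE.trans (hle.trans dis_le_lMlt)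
  have hDF : relDis α ≤ ⁅⁅Dis Q, Dis Q⁆, Dis Q⁆ :=
    relDis_le hl hi fun a b hab => exists_mem_of_rel huniq hl hi hF hab
  exact ⟨le_antisymm hE (hDF.trans hFE), le_antisymm (hFE.trans hE) hDF⟩

/-- Central elements of `Dis(Q)` of exponent `q` are trivial. -/
theorem HasRegularFactor.eq_one_of_central (hα : HasRegularFactor α q)
    (hp : p.Prime) (hq : q.Prime) (hpq : p ≠ q) (hexp : ∀ g ∈ kerDis α, g ^ p = 1)
    (hbot : α ≠ ⊥) (huniq : ∀ β : Congruence Q, β ≠ ⊥ → β ≠ ⊤ → β = α)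
    {g : Equiv.Perm Q} (hg : g ∈ omegaCenter q (Dis Q)) : g = 1 := by
  by_contra hne
  obtain ⟨a, b, hab, hne'⟩ := Congruence.exists_rel_of_ne_bot hbot
  obtain ⟨h, hh, rfl⟩ := exists_mem_of_rel huniq
    ((omegaCenter_le q _).trans dis_le_lMlt) (isInvariant_dis.omegaCenter q)
    (fun hb => hne (by rwa [hb, Subgroup.mem_bot] at hg)) hab
  -- `h` moves `a` within its block, so by regularity on the factor it lies in the kernel; its order
  -- then divides both `p` and `q`.
  have hhp := hexp h (hα.mem h hh.1 a (α.iseqv.symm hab))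
  have : orderOf h ∣ 1 := by
    rw [← (Nat.coprime_primes hp hq).2 hpq]
    exact Nat.dvd_gcd (orderOf_dvd_of_pow_eq_one hhp) (orderOf_dvd_of_pow_eq_one hh.2.2)
  rw [Nat.dvd_one, orderOf_eq_one_iff] at this
  rw [this] at hne'
  exact hne' rfl

end Main

end LSSQuandle

theorem mainTheorem11 (Q : Type*) [Quandle Q] (p q m n : ℕ) (hp : p.Prime) (hq : q.Prime)
    (hpq : p ≠ q) (hQ : LSSQuandle.MemLSS Q (p ^ m) (q ^ n) (LSSQuandle.sigmaRel Q))
    (hγσ : (LSSQuandle.gammaCon Q).toSetoid ≤ LSSQuandle.sigmaRel Q) :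
    (∃ k : ℕ, k ≤ m ∧
      ∃ ρ : Multiplicative (Fin n → ZMod q) →* MulAut (Multiplicative (Fin (m + k) → ZMod p)),
        Function.Injective ρ ∧
        Nonempty (LSSQuandle.Dis Q ≃*
          Multiplicative (Fin (m + k) → ZMod p) ⋊[ρ] Multiplicative (Fin n → ZMod q))) ∧
    (LSSQuandle.Dis Q).lowerCentralSeries 1 = (LSSQuandle.Dis Q).lowerCentralSeries 2 ∧
    (LSSQuandle.Dis Q).lowerCentralSeries 2 = LSSQuandle.relDis (LSSQuandle.gammaCon Q) := by
  open LSSQuandle in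
  obtain ⟨hfin, hconn, hlss, hna, -, -, α, hbot, htop, huniq, hM, hn⟩ := hQ
  have ht := hconn.exists_mem_dis
  obtain ⟨a, b, hab, hne⟩ := Congruence.exists_rel_of_ne_bot hbot
  obtain ⟨c, d, hcd⟩ := Congruence.exists_not_rel_of_ne_top htop
  have : Nonempty Q := ⟨a⟩
  have hm : 1 < p ^ m := by
    rw [← hM a, Finite.one_lt_card_iff_nontrivial, Set.nontrivial_coe_sort]
    exact ⟨a, α.iseqv.refl a, b, hab, hne⟩
  have hn0 : n ≠ 0 := by
    rintro rfl
    rw [pow_zero, Nat.card_eq_one_iff_unique] at hn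
    exact hcd (Quotient.exact (hn.1.elim (Quotient.mk α.toSetoid c) (Quotient.mk α.toSetoid d)))
  have hnt : ∀ a, (α.block a).Nontrivial := fun a => by
    rw [← Set.nontrivial_coe_sort, ← Finite.one_lt_card_iff_nontrivial, hM a]
    exact hm
  have hα := hasRegularFactor hq hlss ht hnt hn hn0
  have hγ := gammaCon_eq hα.isAbelian hna htop huniq
  -- This is `γ_Q ≤ σ_Q`, read through `γ_Q = α`.
  have hσ : ∀ a b, α.r a b → ∀ g ∈ Dis Q, g a = a → g b = b := by
    intro a b hab g hg hga
    rw [← hγ] at hab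
    have h : MulAction.stabilizer (Dis Q) a = MulAction.stabilizer (Dis Q) b := hγσ hab
    have : (⟨g, hg⟩ : Dis Q) ∈ MulAction.stabilizer (Dis Q) a := hga
    rw [h] at this
    exact this
  obtain ⟨hcomm, hexp⟩ := hα.kerDis_comm hp ht hσ hM huniq hbot
  obtain ⟨k, hk, hcard⟩ := hα.exists_card_kerDis hp ht hexp hM htop
    fun g hg a b hab ha hb => eq_one_of_fixes hlss hnt hσ hg hab ha hb
  have hN := hα.isElementaryExtension ht hcomm hexp hcard hn
  obtain ⟨h1, h2⟩ := lowerCentralSeries_dis hN hp hq hpq hna ht huniq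
  refine ⟨⟨k, hk, hN.exists_semidirectProduct hp hq hpq fun g hgq hgc => ?_⟩, ?_, ?_⟩
  · exact Subtype.ext (hα.eq_one_of_central hp hq hpq hexp hbot huniq
      ⟨g.2, fun h hh => congrArg Subtype.val (hgc ⟨h, hh⟩), congrArg Subtype.val hgq⟩)
  · rw [h1, h2]
  · rw [h2, hγ]
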